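/- Let $N_n$ be the $n\times n$ matrix with entries $1$ in the positions $(i,i+1)$ for $1\le i<n$ and $0$ elsewhere, and let $J_n=I_n+N_n$. For integers $1\le r\le s$ and a prime $p$, let $\lambda_1\ge\cdots\ge\lambda_r>0$ be the sizes of the blocks in the Jordan canonical form $J_{\lambda_1}\oplus\cdots\oplus J_{\lambda_r}$ of $J_r\otimes J_s$ over a field of characteristic $p$ (they depend only on $r,s,p$), and let the Norman permutation $\pi(r,s,p)$ be the permutation of $\{1,\dots,r\}$ that sends $n$ to $(r+1-n)+s-\lambda_n$. For $1\le i\le j\le r$ let $\mathrm{Rev}(i,j)$ be the permutation that sends $n$ to $i+j-n$ for $i\le n\le j$ and fixes all other points. For $r'<r$, a permutation of $\{1,\dots,r'\}$ is regarded as a permutation of $\{1,\dots,r\}$ fixing $r'+1,\dots,r$. **Proposition.** Let $1\le r\le s$, let $p$ be a prime and let $m\ge 0$ be an integer with $r\le p^m$. Write $s_{\bmod p^m}$ for the remainder of $s$ on division by $p^m$. In each of the following cases the permutation $\pi(r,s,p)$ is well defined, independently of the field of characteristic $p$, and is given as follows. 0. If $s_{\bmod p^m}=0$, then $\pi(r,s,p)=\mathrm{Rev}(1,r)$.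 1. If $s_{\bmod p^m}=1$ and $r\ge 2$, then $\pi(r,s,p)=\mathrm{Rev}(2,r)$. 2. If $s_{\bmod p^m}=2$ and $r\ge 3$, then $\pi(r,s,p)=(1,2)\circ\mathrm{Rev}(3,r)$ when $p\mid r$, and $\pi(r,s,p)=\mathrm{Rev}(3,r)$ when $p\nmid r$. 3. If $s_{\bmod p^m}=3$ and $r\ge 4$, then $\pi(r,s,p)=\pi(3,r,p)\circ\mathrm{Rev}(4,r)$, where $\pi(3,r,p)$ is also well defined, independently of the field of characteristic $p$. -/

import Mathlib

open scoped Kronecker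

universe u

/-- The unipotent Jordan block `J_n = I_n + N_n`, with `N_n` having entries `1` in the
positions `(i, i + 1)` and `0` elsewhere. -/
def unipotentJordanBlock (F : Type*) [CommRing F] (n : ℕ) : Matrix (Fin n) (Fin n) F :=
  1 + Matrix.of fun i j : Fin n => if (i : ℕ) + 1 = (j : ℕ) then 1 else 0

/-- The square matrix `A` is conjugate to the block diagonal matrix with
blocks `J_{μ k}`, where `k` runs over `κ`. -/
def HasUnipotentJordanForm {F : Type*} [CommRing F] {ι κ : Type*} [Fintype ι] [DecidableEq ι]
    [DecidableEq κ] (A : Matrix ι ι F) (μ : κ → ℕ) : Prop :=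
  ∃ (e : (Σ k, Fin (μ k)) ≃ ι) (P : GL ι F),
    (P : Matrix ι ι F)⁻¹ * A * (P : Matrix ι ι F) =
      Matrix.reindex e e (Matrix.blockDiagonal' fun k => unipotentJordanBlock F (μ k))

/-- `lam 0 ≥ lam 1 ≥ ⋯ ≥ lam (r - 1) > 0` are the block sizes in the Jordan canonical form of
`J_r ⊗ J_s` over `F`; so `lam k` is the part `λ_{k+1}` of the partition `λ` of `r * s`. -/
structure IsJordanPartition (F : Type*) [CommRing F] (r s : ℕ) (lam : Fin r → ℕ) : Prop where
  antitone : Antitone lam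
  pos : ∀ k, 0 < lam k
  jordanForm :
    HasUnipotentJordanForm (unipotentJordanBlock F r ⊗ₖ unipotentJordanBlock F s) lam

/-- `σ` is the Norman permutation of `{1, …, r}` attached to the Jordan form of `J_r ⊗ J_s` over
`F`, i.e. `σ n = (r + 1 - n) + s - λ_n` for `1 ≤ n ≤ r`. A permutation of `{1, …, r}` is viewed as a
permutation of `ℕ` that fixes every point outside `{1, …, r}`, so that the symmetric group on
`{1, …, r'}` is contained in that on `{1, …, r}` for `r' ≤ r`. -/
structure IsNormanPermutation (F : Type*) [CommRing F] (r s : ℕ) (σ : Equiv.Perm ℕ) : Prop where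
  fixes : ∀ n, n ∉ Set.Icc 1 r → σ n = n
  formula : ∃ lam : Fin r → ℕ, IsJordanPartition F r s lam ∧
    ∀ k : Fin r, (σ (k + 1) : ℤ) = ((r : ℤ) + 1 - ((k : ℤ) + 1)) + s - lam k

open Classical in
/-- The Norman permutation `π(r, s, p)`, taken over the prime field of order `p` (and equal to the
identity by convention in case no Norman permutation exists). -/
noncomputable def normanPermutation (r s p : ℕ) : Equiv.Perm ℕ :=
  if h : ∃ σ, IsNormanPermutation (ZMod p) r s σ then h.choose else 1

/-- `π(r, s, p)` is well defined and does not depend on the field of characteristic `p`: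
it is the one and only Norman permutation attached to `J_r ⊗ J_s` over each such field. -/
def NormanPermutationWellDefined (r s p : ℕ) : Prop :=
  ∀ (F : Type u) [Field F] [CharP F p] (σ : Equiv.Perm ℕ),
    IsNormanPermutation F r s σ ↔ σ = normanPermutation r s p

theorem reversal_involutive (i j : ℕ) :
    Function.Involutive fun n : ℕ => if i ≤ n ∧ n ≤ j then j + i - n else n := by
  intro n
  dsimp only
  split_ifs <;> omega

/-- The reversal permutation `Rev(i, j)`: it sends `n` to `j + i - n` for `i ≤ n ≤ j` and fixes all
other points. -/
def reversalPerm (i j : ℕ) : Equiv.Perm ℕ :=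
  (reversal_involutive i j).toPerm

/-!
Put `z = x + y` in `F[x, y] / (x ^ r, y ^ s)`. Multiplication by `z` has the same block sizes as
`J_r ⊗ J_s`. To prove that these are `μ k`, it is enough to find elements `v k`, spanning the
algebra modulo the multiples of `z`, with `z ^ μ k * v k = 0` and `∑ k, μ k = r * s`.

If `r ≤ p ^ m` and `p ^ m ∣ a`, then `z ^ a = y ^ a`. So for `s = a + t` with `t ≤ r`, lifting such
elements from `F[x, y] / (x ^ r, y ^ t)` raises their `μ k` by `a`, and the `r - t` elements
`y ^ t * x ^ i` with `t + i < r`, all killed by `z ^ a`, complete the list. Hence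
`π(r, a + t, p) = π(t, r, p) ∘ Rev(t + 1, r)`, and only `π(t, r, p)` for `t ≤ 3` is left. There
`x ^ t = 0` turns `(z - x) ^ r = 0` into a relation of degree below `t` in `x`, from which the
`v k` are read off. They depend only on which of the following vanish in `F`: `r` for `t = 2`, and
`r`, `r.choose 2` and `(r + 1).choose 2 = r ^ 2 - r.choose 2` for `t = 3`.
-/

section JordanType

variable {R V V' κ : Type*} [CommRing R] [AddCommGroup V] [Module R V] [AddCommGroup V']
  [Module R V']

/-- The endomorphism `f` is nilpotent of Jordan type `μ`: for some vectors `v k`, the vectors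
`f ^ i (v k)` with `i < μ k` form a basis, and `f ^ μ k` kills `v k`. The sizes `μ k` may be listed
in any order, and zeros are allowed. -/
def HasJordanType (f : Module.End R V) (μ : κ → ℕ) : Prop :=
  ∃ (v : κ → V) (b : Module.Basis (Σ k, Fin (μ k)) R V),
    (∀ k, (f ^ μ k) (v k) = 0) ∧ ∀ k i, b ⟨k, i⟩ = (f ^ (i : ℕ)) (v k)

theorem HasJordanType.of_linearEquiv {f : Module.End R V} {g : Module.End R V'} {μ : κ → ℕ}
    (h : HasJordanType f μ) (e : V ≃ₗ[R] V') (he : ∀ a, e (f a) = g (e a)) :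
    HasJordanType g μ := by
  obtain ⟨v, b, hv, hb⟩ := h
  have hpow (n : ℕ) (a : V) : e ((f ^ n) a) = (g ^ n) (e a) := by
    induction n with
    | zero => rfl
    | succ n ih => rw [pow_succ', pow_succ', Module.End.mul_apply, he, ih, Module.End.mul_apply]
  refine ⟨e ∘ v, b.map e, fun k => ?_, fun k i => ?_⟩
  · rw [Function.comp_apply, ← hpow, hv, map_zero]
  · rw [Module.Basis.map_apply, hb, hpow, Function.comp_apply]

theorem HasJordanType.isNilpotent [Finite κ] {f : Module.End R V} {μ : κ → ℕ}
    (h : HasJordanType f μ) : IsNilpotent f := by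
  cases nonempty_fintype κ
  obtain ⟨v, b, hv, hb⟩ := h
  refine ⟨∑ k, μ k, b.ext fun ⟨k, i⟩ => ?_⟩
  have hk : μ k ≤ ∑ k, μ k := Finset.single_le_sum (fun _ _ => Nat.zero_le _) (Finset.mem_univ k)
  rw [hb, ← Module.End.mul_apply, ← pow_add, LinearMap.zero_apply]
  exact Module.End.pow_map_zero_of_le (hk.trans (Nat.le_add_right _ _)) (hv k)

theorem HasJordanType.finrank_range_pow [Nontrivial R] [Fintype κ] {f : Module.End R V}
    {μ : κ → ℕ} (h : HasJordanType f μ) (j : ℕ) :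
    Module.finrank R (LinearMap.range (f ^ j)) = ∑ k, (μ k - j) := by
  obtain ⟨v, b, hv, hb⟩ := h
  let shift (x : Σ k, Fin (μ k - j)) : Σ k, Fin (μ k) := ⟨x.1, ⟨x.2 + j, by omega⟩⟩
  have hshift : Function.Injective shift := by
    rintro ⟨k, i⟩ ⟨k', i'⟩ h
    obtain ⟨rfl, h⟩ := Sigma.mk.inj_iff.1 h
    simpa [Fin.ext_iff] using h
  have hspan : LinearMap.range (f ^ j) = Submodule.span R (Set.range (b ∘ shift)) := by
    rw [LinearMap.range_eq_map, ← b.span_eq, Submodule.map_span]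
    refine le_antisymm (Submodule.span_le.2 ?_) (Submodule.span_mono ?_)
    · rintro _ ⟨_, ⟨⟨k, i⟩, rfl⟩, rfl⟩
      rw [hb, ← Module.End.mul_apply, ← pow_add, add_comm]
      rcases lt_or_ge (i + j) (μ k) with hij | hij
      · exact Submodule.subset_span ⟨⟨k, ⟨i, by omega⟩⟩, hb k ⟨i + j, hij⟩⟩
      · rw [Module.End.pow_map_zero_of_le hij (hv k)]
        exact Submodule.zero_mem _
    · rintro _ ⟨⟨k, i⟩, rfl⟩
      refine ⟨_, ⟨⟨k, ⟨i, by omega⟩⟩, rfl⟩, ?_⟩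
      rw [hb, ← Module.End.mul_apply, ← pow_add, add_comm]
      exact (hb k ⟨i + j, _⟩).symm
  rw [hspan, finrank_span_eq_card (b.linearIndependent.comp shift hshift)]
  simp

end JordanType

theorem eq_of_antitone_of_sum_tsub_eq {n : ℕ} {f g : Fin n → ℕ} (hf : Antitone f)
    (hg : Antitone g) (h : ∀ j, ∑ k, (f k - j) = ∑ k, (g k - j)) : f = g := by
  have sum_tsub_eq (f : Fin n → ℕ) (j : ℕ) :
      ∑ k, (f k - j) = ∑ k, (f k - (j + 1)) + (Finset.univ.filter (j < f ·)).card := by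
    rw [Finset.card_filter, ← Finset.sum_add_distrib]
    refine Finset.sum_congr rfl fun k _ => ?_
    split_ifs <;> omega
  have card_eq (j : ℕ) :
      (Finset.univ.filter (j < f ·)).card = (Finset.univ.filter (j < g ·)).card := by
    have := sum_tsub_eq f j
    have := sum_tsub_eq g j
    have := h j
    have := h (j + 1)
    omega
  have filter_eq (j : ℕ) : Finset.univ.filter (j < f ·) = Finset.univ.filter (j < g ·) := by
    have lower {f : Fin n → ℕ} (hf : Antitone f) :
        IsLowerSet (Finset.univ.filter (j < f ·) : Set (Fin n)) := fun a b hba ha => by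
      simp only [Finset.coe_filter, Finset.mem_univ, true_and, Set.mem_ofPred_eq] at ha ⊢
      exact ha.trans_le (hf hba)
    rcases (lower hf).total (lower hg) with hfg | hgf
    · exact Finset.eq_of_subset_of_card_le (Finset.coe_subset.1 hfg) (card_eq j).ge
    · exact (Finset.eq_of_subset_of_card_le (Finset.coe_subset.1 hgf) (card_eq j).le).symm
  funext k
  refine eq_of_forall_lt_iff fun j => ?_
  simpa using Finset.ext_iff.1 (filter_eq j) k

theorem HasJordanType.eq_of_antitone {R V : Type*} [CommRing R] [Nontrivial R] [AddCommGroup V]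
    [Module R V] {n : ℕ} {f : Module.End R V} {μ ν : Fin n → ℕ} (hf : HasJordanType f μ)
    (hg : HasJordanType f ν) (hμ : Antitone μ) (hν : Antitone ν) : μ = ν :=
  eq_of_antitone_of_sum_tsub_eq hμ hν fun j => by
    rw [← hf.finrank_range_pow, ← hg.finrank_range_pow]

section Generators

variable {F V κ : Type*} [Field F] [AddCommGroup V] [Module F V]
  {f : Module.End F V} {μ : κ → ℕ}

theorem eq_top_of_sup_range_eq_top {R V : Type*} [Semiring R] [AddCommMonoid V] [Module R V]
    {f : Module.End R V} (hf : IsNilpotent f) {W : Submodule R V} (hW : W ≤ W.comap f)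
    (h : W ⊔ LinearMap.range f = ⊤) : W = ⊤ := by
  have hsup (n : ℕ) : W ⊔ LinearMap.range (f ^ n) = ⊤ := by
    induction n with
    | zero => rw [pow_zero, Module.End.one_eq_id, LinearMap.range_id, sup_top_eq]
    | succ n ih =>
      have hmap : W.map (f ^ n) ≤ W := Submodule.map_le_iff_le_comap.2
        (W.le_comap_pow_of_le_comap hW n)
      rw [eq_top_iff, ← ih, sup_le_iff, LinearMap.range_eq_map (f ^ n), ← h, Submodule.map_sup,
        pow_succ, Module.End.mul_eq_comp, LinearMap.range_comp]
      exact ⟨le_sup_left, sup_le_sup_right hmap _⟩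
  obtain ⟨n, hn⟩ := hf
  simpa [hn] using hsup n

theorem hasJordanType_iff_exists_generators [Fintype κ] : HasJordanType f μ ↔
    IsNilpotent f ∧ ∑ k, μ k = Module.finrank F V ∧ ∃ v : κ → V, (∀ k, (f ^ μ k) (v k) = 0) ∧
      Submodule.span F (Set.range v) ⊔ LinearMap.range f = ⊤ := by
  constructor
  · rintro ⟨v, b, hv, hb⟩
    refine ⟨HasJordanType.isNilpotent ⟨v, b, hv, hb⟩, ?_, v, hv, ?_⟩
    · rw [Module.finrank_eq_card_basis b]
      simp
    · rw [eq_top_iff, ← b.span_eq, Submodule.span_le]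
      rintro _ ⟨⟨k, ⟨i, hi⟩⟩, rfl⟩
      rw [hb]
      cases i with
      | zero => exact Submodule.mem_sup_left (Submodule.subset_span ⟨k, rfl⟩)
      | succ i =>
        rw [pow_succ', Module.End.mul_apply]
        exact Submodule.mem_sup_right (LinearMap.mem_range_self _ _)
  · rintro ⟨hf, hdim, v, hv, hspan⟩
    let chain (x : Σ k, Fin (μ k)) : V := (f ^ (x.2 : ℕ)) (v x.1)
    have chain_mem (k : κ) (i : ℕ) : (f ^ i) (v k) ∈ Submodule.span F (Set.range chain) := by
      rcases lt_or_ge i (μ k) with hi | hi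
      · exact Submodule.subset_span ⟨⟨k, ⟨i, hi⟩⟩, rfl⟩
      · rw [Module.End.pow_map_zero_of_le hi (hv k)]
        exact Submodule.zero_mem _
    have chain_span : Submodule.span F (Set.range chain) = ⊤ := by
      refine eq_top_of_sup_range_eq_top hf ?_ ?_
      · rw [Submodule.span_le]
        rintro _ ⟨⟨k, i⟩, rfl⟩
        rw [SetLike.mem_coe, Submodule.mem_comap, ← Module.End.mul_apply, ← pow_succ']
        exact chain_mem k _
      · rw [eq_top_iff, ← hspan]
        refine sup_le_sup_right (Submodule.span_le.2 ?_) _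
        rintro _ ⟨k, rfl⟩
        exact chain_mem k 0
    exact ⟨v, basisOfTopLeSpanOfCardEqFinrank chain chain_span.ge (by simpa using hdim), hv,
      fun k i => by rw [coe_basisOfTopLeSpanOfCardEqFinrank]⟩

theorem HasJordanType.mul_of_isUnit [Finite κ] (h : HasJordanType f μ) {g : Module.End F V}
    (hg : IsUnit g) (hgf : Commute f g) : HasJordanType (f * g) μ := by
  cases nonempty_fintype κ
  obtain ⟨hf, hdim, v, hv, hspan⟩ := hasJordanType_iff_exists_generators.1 h
  refine hasJordanType_iff_exists_generators.2 ⟨hgf.isNilpotent_mul_right hf, hdim, v, ?_, ?_⟩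
  · intro k
    rw [hgf.mul_pow, (hgf.pow_pow _ _).eq, Module.End.mul_apply, hv, map_zero]
  · have hrange : LinearMap.range g = ⊤ :=
      LinearMap.range_eq_top.2 ((Module.End.isUnit_iff g).1 hg).surjective
    rw [Module.End.mul_eq_comp, LinearMap.range_comp, hrange, ← LinearMap.range_eq_map, hspan]

theorem hasJordanType_mulLeft_mul_iff [Finite κ] {A : Type*} [CommRing A] [Algebra F A]
    {a ε : A} (hε : IsUnit ε) :
    HasJordanType (LinearMap.mulLeft F (a * ε)) μ ↔ HasJordanType (LinearMap.mulLeft F a) μ := by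
  have mul_of_isUnit {a ε : A} (h : HasJordanType (LinearMap.mulLeft F a) μ) (hε : IsUnit ε) :
      HasJordanType (LinearMap.mulLeft F (a * ε)) μ := by
    rw [LinearMap.mulLeft_mul]
    exact h.mul_of_isUnit (hε.map (Algebra.lmul F A))
      ((Commute.all a ε).map (Algebra.lmul F A))
  refine ⟨fun h => ?_, fun h => mul_of_isUnit h hε⟩
  obtain ⟨ε, rfl⟩ := hε
  simpa using mul_of_isUnit h ε⁻¹.isUnit

end Generators

section Matrix

variable {R S V ι κ : Type*} [CommRing R] [AddCommGroup V] [Module R V]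

theorem unipotentJordanBlock_map [CommRing S] (φ : R →+* S) (n : ℕ) :
    (unipotentJordanBlock R n).map φ = unipotentJordanBlock S n := by
  ext i j
  simp [unipotentJordanBlock, Matrix.one_apply, apply_ite φ]

theorem HasUnipotentJordanForm.map [CommRing S] [Fintype ι] [DecidableEq ι] [DecidableEq κ]
    {A : Matrix ι ι R} {μ : κ → ℕ} (h : HasUnipotentJordanForm A μ) (φ : R →+* S) :
    HasUnipotentJordanForm (A.map φ) μ := by
  obtain ⟨e, P, hP⟩ := h
  refine ⟨e, Matrix.GeneralLinearGroup.map φ P, ?_⟩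
  have hmap := congrArg φ.mapMatrix hP
  rw [← Matrix.coe_units_inv] at hmap ⊢
  rw [map_mul, map_mul] at hmap
  rw [← map_inv]
  refine hmap.trans ?_
  simp only [RingHom.mapMatrix_apply, Matrix.reindex_apply, ← Matrix.submatrix_map,
    Matrix.blockDiagonal'_map _ _ (map_zero φ), unipotentJordanBlock_map]

theorem sum_unipotentJordanBlock_smul {n : ℕ} (v : Fin n → V) (i : Fin n) :
    ∑ j, unipotentJordanBlock R n j i • v j =
      v i + if (i : ℕ) = 0 then 0 else v ⟨i - 1, by omega⟩ := by
  simp only [unipotentJordanBlock, Matrix.add_apply, Matrix.of_apply, add_smul,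
    Finset.sum_add_distrib, Matrix.one_apply, ite_smul, one_smul, zero_smul, Finset.sum_ite_eq',
    Finset.mem_univ, if_true]
  congr 1
  split_ifs with hi
  · exact Finset.sum_eq_zero fun j _ => if_neg (by omega)
  · rw [Finset.sum_eq_single ⟨i - 1, by omega⟩ (fun j _ hj => if_neg fun h => hj ?_) (by simp)]
    · exact if_pos (Nat.sub_add_cancel (Nat.one_le_iff_ne_zero.2 hi))
    · exact Fin.ext (Nat.eq_sub_of_add_eq h)

theorem toMatrix_eq_iff_apply_basis_eq_sum [Fintype ι] [DecidableEq ι] (b : Module.Basis ι R V)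
    {f : Module.End R V} {M : Matrix ι ι R} :
    LinearMap.toMatrix b b f = M ↔ ∀ i, f (b i) = ∑ j, M j i • b j := by
  rw [← (Matrix.toLin b b).injective.eq_iff, Matrix.toLin_toMatrix]
  simp only [← Matrix.toLin_self b b]
  exact ⟨fun h i => h ▸ rfl, b.ext⟩

theorem toMatrix_eq_blockDiagonal'_unipotentJordanBlock_iff [Fintype κ] [DecidableEq κ]
    {μ : κ → ℕ} (b : Module.Basis (Σ k, Fin (μ k)) R V) {f : Module.End R V} :
    LinearMap.toMatrix b b f = Matrix.blockDiagonal' (fun k => unipotentJordanBlock R (μ k)) ↔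
      ∀ k i, (f - 1) (b ⟨k, i⟩) = if (i : ℕ) = 0 then 0 else b ⟨k, ⟨i - 1, by omega⟩⟩ := by
  have hsum (k : κ) (i : Fin (μ k)) :
      ∑ x, Matrix.blockDiagonal' (fun k => unipotentJordanBlock R (μ k)) x ⟨k, i⟩ • b x =
        b ⟨k, i⟩ + if (i : ℕ) = 0 then 0 else b ⟨k, ⟨i - 1, by omega⟩⟩ := by
    rw [Fintype.sum_sigma, Finset.sum_eq_single k, ← sum_unipotentJordanBlock_smul (R := R)
      (fun i => b ⟨k, i⟩)]
    · simp only [Matrix.blockDiagonal'_apply_eq]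
    · exact fun k' _ hk => Finset.sum_eq_zero fun i' _ => by
        rw [Matrix.blockDiagonal'_apply_ne _ _ _ hk, zero_smul]
    · simp
  simp only [toMatrix_eq_iff_apply_basis_eq_sum, Sigma.forall, hsum, LinearMap.sub_apply,
    Module.End.one_apply, sub_eq_iff_eq_add']

theorem hasJordanType_iff_exists_basis {f : Module.End R V} {μ : κ → ℕ} : HasJordanType f μ ↔
    ∃ b : Module.Basis (Σ k, Fin (μ k)) R V,
      ∀ k i, f (b ⟨k, i⟩) = if (i : ℕ) = 0 then 0 else b ⟨k, ⟨i - 1, by omega⟩⟩ := by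
  let rev : (Σ k, Fin (μ k)) ≃ Σ k, Fin (μ k) := Equiv.sigmaCongrRight fun _ => Fin.revPerm
  constructor
  · rintro ⟨v, b, hv, hb⟩
    have hrev (k : κ) (i : Fin (μ k)) : b.reindex rev ⟨k, i⟩ = (f ^ (μ k - (i + 1))) (v k) := by
      rw [Module.Basis.reindex_apply]
      exact hb k i.rev
    refine ⟨b.reindex rev, fun k i => ?_⟩
    rw [hrev, ← Module.End.mul_apply, ← pow_succ']
    split_ifs with hi
    · rw [show μ k - (i + 1) + 1 = μ k by omega, hv]
    · rw [hrev]
      congr 2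
      dsimp only
      omega
  · rintro ⟨b, hb⟩
    let v (k : κ) : V := if h : 0 < μ k then b ⟨k, ⟨μ k - 1, by omega⟩⟩ else 0
    have hpow (k : κ) (i : Fin (μ k)) : b.reindex rev ⟨k, i⟩ = (f ^ (i : ℕ)) (v k) := by
      obtain ⟨i, hi⟩ := i
      rw [Module.Basis.reindex_apply]
      change b ⟨k, Fin.rev ⟨i, hi⟩⟩ = _
      induction i with
      | zero => simp [v, hi, Fin.rev]
      | succ i ih =>
        rw [pow_succ', Module.End.mul_apply, ← ih (by omega), hb, if_neg (by simp; omega)]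
        rfl
    refine ⟨v, b.reindex rev, fun k => ?_, hpow⟩
    rcases Nat.eq_zero_or_pos (μ k) with hk | hk
    · simp [v, hk]
    · have hlast := hpow k ⟨μ k - 1, by omega⟩
      rw [Module.Basis.reindex_apply] at hlast
      rw [← Nat.sub_add_cancel hk, pow_succ', Module.End.mul_apply, ← hlast]
      exact (hb k _).trans (if_pos (by simp; omega))

theorem exists_toMatrix_eq [Fintype ι] [DecidableEq ι] (c : Module.Basis ι R V) (P : GL ι R) :
    ∃ b : Module.Basis ι R V, c.toMatrix b = P := by
  refine ⟨c.map (Matrix.toLinearEquiv c P (Matrix.isUnits_det_units P)), ?_⟩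
  ext i j
  simp [Module.Basis.toMatrix_apply, Matrix.toLin_self, Finsupp.single_apply]

theorem toMatrix_reindex_reindex [Fintype ι] [DecidableEq ι] [Fintype κ] [DecidableEq κ]
    (b : Module.Basis ι R V) (e : ι ≃ κ) (f : Module.End R V) :
    LinearMap.toMatrix (b.reindex e) (b.reindex e) f =
      Matrix.reindex e e (LinearMap.toMatrix b b f) := by
  ext i j
  simp [LinearMap.toMatrix_apply]

theorem hasUnipotentJordanForm_toMatrix_iff [Nontrivial R] [Fintype ι] [DecidableEq ι] [Finite κ]
    [DecidableEq κ] (c : Module.Basis ι R V) {f : Module.End R V} {μ : κ → ℕ} :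
    HasUnipotentJordanForm (LinearMap.toMatrix c c f) μ ↔ HasJordanType (f - 1) μ := by
  cases nonempty_fintype κ
  simp only [hasJordanType_iff_exists_basis, ← toMatrix_eq_blockDiagonal'_unipotentJordanBlock_iff]
  have conj (b : Module.Basis ι R V) :
      (c.toMatrix b)⁻¹ * LinearMap.toMatrix c c f * c.toMatrix b = LinearMap.toMatrix b b f := by
    rw [Matrix.inv_eq_right_inv (c.toMatrix_mul_toMatrix_flip b),
      basis_toMatrix_mul_linearMap_toMatrix_mul_basis_toMatrix]
  constructor
  · rintro ⟨e, P, hP⟩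
    obtain ⟨b, hb⟩ := exists_toMatrix_eq c P
    refine ⟨b.reindex e.symm, ?_⟩
    rw [toMatrix_reindex_reindex, ← conj, hb, hP, ← Matrix.reindex_symm, Equiv.symm_apply_apply]
  · rintro ⟨b, hb⟩
    let b' := b.reindex (b.indexEquiv c)
    refine ⟨b.indexEquiv c, ⟨c.toMatrix b', b'.toMatrix c, c.toMatrix_mul_toMatrix_flip b',
      b'.toMatrix_mul_toMatrix_flip c⟩, ?_⟩
    rw [conj, toMatrix_reindex_reindex, hb]

end Matrix

open Polynomial TensorProduct

/-- The truncated polynomial algebra `F[X] / (X ^ n)`. -/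
abbrev TruncatedPolynomial (F : Type*) [CommRing F] (n : ℕ) : Type _ :=
  AdjoinRoot (X ^ n : F[X])

namespace TruncatedPolynomial

theorem root_pow (F : Type*) [CommRing F] (n : ℕ) : AdjoinRoot.root (X ^ n : F[X]) ^ n = 0 := by
  simpa using AdjoinRoot.eval₂_root (X ^ n : F[X])

theorem algHomOfDvd_mk {F : Type*} [CommRing F] {s t : ℕ} (h : t ≤ s) (f : F[X]) :
    AdjoinRoot.algHomOfDvd F (X ^ s : F[X]) (X ^ t) (pow_dvd_pow X h) (AdjoinRoot.mk _ f) =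
      AdjoinRoot.mk _ f := by
  rw [← AdjoinRoot.aeval_eq, ← aeval_algHom_apply, AdjoinRoot.algHomOfDvd_root,
    AdjoinRoot.aeval_eq]

theorem algHomOfDvd_surjective {F : Type*} [CommRing F] {s t : ℕ} (h : t ≤ s) :
    Function.Surjective
      (AdjoinRoot.algHomOfDvd F (X ^ s : F[X]) (X ^ t) (pow_dvd_pow X h)) := fun a => by
  obtain ⟨f, rfl⟩ := AdjoinRoot.mk_surjective a
  exact ⟨AdjoinRoot.mk _ f, algHomOfDvd_mk h f⟩

theorem root_pow_dvd_of_algHomOfDvd_eq_zero {F : Type*} [CommRing F] {s t : ℕ} (h : t ≤ s)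
    {a : TruncatedPolynomial F s}
    (ha : AdjoinRoot.algHomOfDvd F (X ^ s : F[X]) (X ^ t) (pow_dvd_pow X h) a = 0) :
    AdjoinRoot.root (X ^ s : F[X]) ^ t ∣ a := by
  obtain ⟨f, rfl⟩ := AdjoinRoot.mk_surjective a
  rw [algHomOfDvd_mk h, AdjoinRoot.mk_eq_zero] at ha
  simpa using map_dvd (AdjoinRoot.mk (X ^ s)) ha

theorem hasJordanType_mulLeft_root (F : Type*) [Field F] (n : ℕ) :
    HasJordanType (LinearMap.mulLeft F (AdjoinRoot.root (X ^ n : F[X]))) fun _ : Unit => n := by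
  let b := AdjoinRoot.powerBasis' (monic_X_pow (R := F) n)
  have hdim : b.dim = n := by simp [b]
  refine ⟨fun _ => 1, b.basis.reindex ((finCongr hdim).trans
    (Equiv.uniqueSigma fun _ : Unit => Fin n).symm), fun _ => ?_, fun _ i => ?_⟩
  · rw [LinearMap.pow_mulLeft, root_pow, LinearMap.mulLeft_zero_eq_zero, LinearMap.zero_apply]
  · simp only [Module.Basis.reindex_apply, PowerBasis.coe_basis, LinearMap.pow_mulLeft,
      LinearMap.mulLeft_apply, mul_one, b, AdjoinRoot.powerBasis'_gen]
    rfl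

theorem exists_basis_toMatrix_mulLeft (F : Type*) [Field F] (n : ℕ) {ε : TruncatedPolynomial F n}
    (hε : IsUnit ε) : ∃ b : Module.Basis (Fin n) F (TruncatedPolynomial F n),
      LinearMap.toMatrix b b (LinearMap.mulLeft F (1 + AdjoinRoot.root (X ^ n : F[X]) * ε)) =
        unipotentJordanBlock F n := by
  let e : (Σ _ : Unit, Fin n) ≃ Fin n := Equiv.uniqueSigma fun _ => Fin n
  obtain ⟨b, hb⟩ := hasJordanType_iff_exists_basis.1
    ((hasJordanType_mulLeft_mul_iff hε).2 (hasJordanType_mulLeft_root F n))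
  refine ⟨b.reindex e, toMatrix_eq_iff_apply_basis_eq_sum _ |>.2 fun i => ?_⟩
  rw [sum_unipotentJordanBlock_smul, LinearMap.mulLeft_apply, add_mul, one_mul]
  simp only [Module.Basis.reindex_apply]
  exact congrArg (b ⟨(), i⟩ + ·) (hb () i)

theorem finrank_eq (F : Type*) [Field F] (n : ℕ) :
    Module.finrank F (TruncatedPolynomial F n) = n := by
  simpa using (hasJordanType_iff_exists_generators.1 (hasJordanType_mulLeft_root F n)).2.1.symm

end TruncatedPolynomial

/-- The algebra `F[x, y] / (x ^ r, y ^ s)`. -/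
abbrev TruncatedTensor (F : Type*) [CommRing F] (r s : ℕ) : Type _ :=
  TruncatedPolynomial F r ⊗[F] TruncatedPolynomial F s

namespace TruncatedTensor

/-- The generator `x` of `F[x, y] / (x ^ r, y ^ s)`. -/
noncomputable def x (F : Type*) [CommRing F] (r s : ℕ) : TruncatedTensor F r s :=
  AdjoinRoot.root (X ^ r : F[X]) ⊗ₜ 1

/-- The generator `y` of `F[x, y] / (x ^ r, y ^ s)`. -/
noncomputable def y (F : Type*) [CommRing F] (r s : ℕ) : TruncatedTensor F r s :=
  1 ⊗ₜ AdjoinRoot.root (X ^ s : F[X])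

section CommRing

variable (F : Type*) [CommRing F] (r s : ℕ)

theorem x_pow : x F r s ^ r = 0 := by
  rw [x, Algebra.TensorProduct.tmul_pow, TruncatedPolynomial.root_pow, zero_tmul]

theorem y_pow : y F r s ^ s = 0 := by
  rw [y, Algebra.TensorProduct.tmul_pow, TruncatedPolynomial.root_pow, tmul_zero]

theorem isNilpotent_x_add_y : IsNilpotent (x F r s + y F r s) :=
  (Commute.all _ _).isNilpotent_add ⟨r, x_pow F r s⟩ ⟨s, y_pow F r s⟩

variable {F r s}

theorem eq_top_of_x_pow_mem {W : Submodule F (TruncatedTensor F r s)}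
    (hz : ∀ a, (x F r s + y F r s) * a ∈ W) (hx : ∀ i < r, x F r s ^ i ∈ W) : W = ⊤ := by
  have aeval_x_mem (f : F[X]) : aeval (x F r s) f ∈ W := by
    rw [aeval_eq_sum_range]
    refine W.sum_mem fun i _ => W.smul_mem _ ?_
    rcases lt_or_ge i r with hi | hi
    · exact hx i hi
    · rw [pow_eq_zero_of_le hi (x_pow F r s)]
      exact W.zero_mem
  have tmul_eq (f g : F[X]) : (AdjoinRoot.mk (X ^ r) f ⊗ₜ AdjoinRoot.mk (X ^ s) g :
      TruncatedTensor F r s) = aeval (x F r s) f * aeval (y F r s) g := by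
    have hf := aeval_algHom_apply (Algebra.TensorProduct.includeLeft : _ →ₐ[F]
      TruncatedTensor F r s) (AdjoinRoot.root (X ^ r : F[X])) f
    have hg := aeval_algHom_apply (Algebra.TensorProduct.includeRight : _ →ₐ[F]
      TruncatedTensor F r s) (AdjoinRoot.root (X ^ s : F[X])) g
    rw [AdjoinRoot.aeval_eq] at hf hg
    exact (by simp : _ = _ * _).trans (congrArg₂ (· * ·) hf hg).symm
  rw [Submodule.eq_top_iff']
  intro a
  induction a using TensorProduct.induction_on with
  | zero => exact W.zero_mem
  | add a b ha hb => exact W.add_mem ha hb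
  | tmul a b =>
    obtain ⟨f, rfl⟩ := AdjoinRoot.mk_surjective a
    obtain ⟨g, rfl⟩ := AdjoinRoot.mk_surjective b
    obtain ⟨d, hd⟩ := (g.map (algebraMap F (TruncatedTensor F r s))).sub_dvd_eval_sub
      (y F r s) (-x F r s)
    rw [eval_map_algebraMap, eval_map_algebraMap, sub_eq_iff_eq_add] at hd
    have hcomp : aeval (-x F r s) g = aeval (x F r s) (g.comp (-X)) := by
      simp [aeval_comp]
    rw [tmul_eq, hd, mul_add, hcomp, ← map_mul]
    refine W.add_mem ?_ (aeval_x_mem _)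
    convert hz (aeval (x F r s) f * d) using 1
    ring

variable {t : ℕ}

/-- The quotient map `F[x, y] / (x ^ r, y ^ s) → F[x, y] / (x ^ r, y ^ t)` for `t ≤ s`. -/
noncomputable def truncate (h : t ≤ s) : TruncatedTensor F r s →ₐ[F] TruncatedTensor F r t :=
  Algebra.TensorProduct.map (AlgHom.id F _) (AdjoinRoot.algHomOfDvd F _ _ (pow_dvd_pow X h))

theorem truncate_x (h : t ≤ s) : truncate h (x F r s) = x F r t := by
  simp [truncate, x]

theorem truncate_y (h : t ≤ s) : truncate h (y F r s) = y F r t := by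
  simp [truncate, y]

theorem truncate_surjective (h : t ≤ s) :
    Function.Surjective (truncate h : TruncatedTensor F r s →ₐ[F] _) :=
  TensorProduct.map_surjective Function.surjective_id
    (TruncatedPolynomial.algHomOfDvd_surjective h)

theorem y_pow_dvd_of_truncate_eq_zero (h : t ≤ s) {a : TruncatedTensor F r s}
    (ha : truncate h a = 0) : y F r s ^ t ∣ a := by
  have hker := Algebra.TensorProduct.lTensor_ker (A := TruncatedPolynomial F r) _
    (TruncatedPolynomial.algHomOfDvd_surjective (F := F) h)
  rw [← Ideal.mem_span_singleton]
  refine (hker.trans_le (Ideal.map_le_iff_le_comap.2 fun b hb => ?_)) ha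
  obtain ⟨c, rfl⟩ := TruncatedPolynomial.root_pow_dvd_of_algHomOfDvd_eq_zero h hb
  refine Ideal.mem_span_singleton.2 ⟨1 ⊗ₜ c, ?_⟩
  simp [y, Algebra.TensorProduct.tmul_pow]

theorem y_pow_mul_mem {W : Submodule F (TruncatedTensor F r s)}
    (hz : ∀ a, (x F r s + y F r s) * a ∈ W) (hx : ∀ i, t + i < r → y F r s ^ t * x F r s ^ i ∈ W)
    (a : TruncatedTensor F r s) : y F r s ^ t * a ∈ W := by
  suffices W.comap (LinearMap.mulLeft F (y F r s ^ t)) = ⊤ from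
    this.ge (Submodule.mem_top (x := a))
  refine eq_top_of_x_pow_mem (fun a => ?_) fun i _ => ?_
  · rw [Submodule.mem_comap, LinearMap.mulLeft_apply, mul_left_comm]
    exact hz _
  · rw [Submodule.mem_comap, LinearMap.mulLeft_apply]
    rcases lt_or_ge (t + i) r with hi | hi
    · exact hx i hi
    · obtain ⟨c, hc⟩ := sub_dvd_pow_sub_pow (y F r s) (-x F r s) t
      have hzero : x F r s ^ t * x F r s ^ i = 0 := by
        rw [← pow_add, pow_eq_zero_of_le hi (x_pow F r s)]
      convert hz (c * x F r s ^ i) using 1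
      rw [neg_pow] at hc
      linear_combination x F r s ^ i * hc + (-1) ^ t * hzero

theorem eq_top_of_map_truncate_eq_top (h : t ≤ s) {W : Submodule F (TruncatedTensor F r s)}
    (hW : W.map (truncate h).toLinearMap = ⊤) (hy : ∀ a, y F r s ^ t * a ∈ W) : W = ⊤ := by
  rw [Submodule.eq_top_iff']
  intro a
  obtain ⟨b, hb, hab⟩ := hW.ge (Submodule.mem_top (x := truncate h a))
  obtain ⟨c, hc⟩ := y_pow_dvd_of_truncate_eq_zero h
    (show truncate h (a - b) = 0 by rw [map_sub, sub_eq_zero]; exact hab.symm)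
  rw [sub_eq_iff_eq_add.1 hc]
  exact W.add_mem (hy c) hb

theorem x_add_y_pow_of_dvd {p m a : ℕ} [CharP F p] (hp : p.Prime) (hr : r ≤ p ^ m)
    (ha : p ^ m ∣ a) : (x F r s + y F r s) ^ a = y F r s ^ a := by
  obtain ⟨b, rfl⟩ := ha
  have hp0 : (p : TruncatedTensor F r s) = 0 := by
    rw [← map_natCast (algebraMap F _), CharP.cast_eq_zero, map_zero]
  obtain ⟨c, hc⟩ := exists_add_pow_prime_pow_eq hp (x F r s) (y F r s) m
  rw [pow_mul, pow_mul, hc, hp0, pow_eq_zero_of_le hr (x_pow F r s)]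
  simp

end CommRing

variable (F : Type*) [Field F] (r s : ℕ)

theorem finrank_eq : Module.finrank F (TruncatedTensor F r s) = r * s := by
  rw [Module.finrank_tensorProduct, TruncatedPolynomial.finrank_eq, TruncatedPolynomial.finrank_eq]

variable {F r s} {κ : Type*} {μ : κ → ℕ}

theorem hasJordanType_of_generators [Fintype κ] (hμ : ∑ k, μ k = r * s)
    (v : κ → TruncatedTensor F r s) (hv : ∀ k, (x F r s + y F r s) ^ μ k * v k = 0)
    (hx : ∀ i < r, x F r s ^ i ∈ Submodule.span F (Set.range v) ⊔
      LinearMap.range (LinearMap.mulLeft F (x F r s + y F r s))) :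
    HasJordanType (LinearMap.mulLeft F (x F r s + y F r s)) μ := by
  refine hasJordanType_iff_exists_generators.2
    ⟨(LinearMap.isNilpotent_mulLeft_iff F _).2 (isNilpotent_x_add_y F r s),
      hμ.trans (finrank_eq F r s).symm, v, fun k => ?_, eq_top_of_x_pow_mem (fun a => ?_) hx⟩
  · rw [LinearMap.pow_mulLeft]
    exact hv k
  · exact Submodule.mem_sup_right ⟨a, rfl⟩

theorem hasJordanType_swap_iff :
    HasJordanType (LinearMap.mulLeft F (x F s r + y F s r)) μ ↔
      HasJordanType (LinearMap.mulLeft F (x F r s + y F r s)) μ := by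
  have swap {r s : ℕ} (h : HasJordanType (LinearMap.mulLeft F (x F r s + y F r s)) μ) :
      HasJordanType (LinearMap.mulLeft F (x F s r + y F s r)) μ := by
    let e := Algebra.TensorProduct.comm F (TruncatedPolynomial F r) (TruncatedPolynomial F s)
    have he : e (x F r s + y F r s) = x F s r + y F s r := by
      simp [e, x, y, add_comm]
    exact h.of_linearEquiv e.toLinearEquiv fun a => by
      simp only [LinearMap.mulLeft_apply, ← he]
      exact map_mul e _ _
  exact ⟨swap, swap⟩

theorem hasUnipotentJordanForm_kronecker_iff [Finite κ] [DecidableEq κ] :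
    HasUnipotentJordanForm (unipotentJordanBlock F r ⊗ₖ unipotentJordanBlock F s) μ ↔
      HasJordanType (LinearMap.mulLeft F (x F r s + y F r s)) μ := by
  set ρ := AdjoinRoot.root (X ^ r : F[X])
  set τ := AdjoinRoot.root (X ^ s : F[X])
  obtain ⟨η, hη⟩ := (IsNilpotent.isUnit_one_sub
    ⟨s, TruncatedPolynomial.root_pow F s⟩ : IsUnit (1 - τ)).exists_right_inv
  have hη_unit : IsUnit η := IsUnit.of_mul_eq_one_right _ hη
  obtain ⟨b, hb⟩ := TruncatedPolynomial.exists_basis_toMatrix_mulLeft F r isUnit_one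
  obtain ⟨c, hc⟩ := TruncatedPolynomial.exists_basis_toMatrix_mulLeft F s hη_unit
  -- Replacing `1 + y` by `(1 - y)⁻¹`, which has the same Jordan block, makes
  -- `(1 + x) * (1 - y)⁻¹ - 1` a unit multiple of `x + y`.
  have hmul : TensorProduct.map (LinearMap.mulLeft F (1 + ρ * 1)) (LinearMap.mulLeft F (1 + τ * η))
      - 1 = LinearMap.mulLeft F ((x F r s + y F r s) * 1 ⊗ₜ η) := by
    have hη' : 1 + τ * η = η := by linear_combination -hη
    have hmul' : (1 + ρ * 1) ⊗ₜ (1 + τ * η) - 1 = (x F r s + y F r s) * 1 ⊗ₜ η := by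
      rw [mul_one, add_tmul, tmul_add 1, hη', ← Algebra.TensorProduct.one_def]
      simp only [x, y, add_mul, Algebra.TensorProduct.tmul_mul_tmul, one_mul, mul_one]
      ring
    rw [← LinearMap.mulLeft_tmul, ← hmul', Module.End.one_eq_id, ← LinearMap.mulLeft_one F]
    exact (map_sub (LinearMap.mul F (TruncatedTensor F r s)) _ _).symm
  rw [← hb, ← hc, ← TensorProduct.toMatrix_map, hasUnipotentJordanForm_toMatrix_iff, hmul,
    hasJordanType_mulLeft_mul_iff]
  exact hη_unit.map (Algebra.TensorProduct.includeRight : _ →ₐ[F] TruncatedTensor F r s)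

theorem hasJordanType_append {p m a t d : ℕ} [CharP F p] (hp : p.Prime) (hm : t + d ≤ p ^ m)
    (ha : p ^ m ∣ a) {μ : Fin t → ℕ}
    (h : HasJordanType (LinearMap.mulLeft F (x F (t + d) t + y F (t + d) t)) μ) :
    HasJordanType (LinearMap.mulLeft F (x F (t + d) (a + t) + y F (t + d) (a + t)))
      (Fin.append (fun k => a + μ k) fun _ : Fin d => a) := by
  obtain ⟨-, hμ, v, hv, hspan⟩ := hasJordanType_iff_exists_generators.1 h
  have hta : t ≤ a + t := Nat.le_add_left t a
  choose w hw using fun k => truncate_surjective hta (v k)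
  let g := Fin.append w fun j : Fin d => y F (t + d) (a + t) ^ t * x F (t + d) (a + t) ^ (j : ℕ)
  let W := Submodule.span F (Set.range g) ⊔
    LinearMap.range (LinearMap.mulLeft F (x F (t + d) (a + t) + y F (t + d) (a + t)))
  have mul_mem (e) : (x F (t + d) (a + t) + y F (t + d) (a + t)) * e ∈ W :=
    Submodule.mem_sup_right ⟨e, rfl⟩
  have gen_mem (k) : g k ∈ W := Submodule.mem_sup_left (Submodule.subset_span ⟨k, rfl⟩)
  have hW : W = ⊤ := by
    refine eq_top_of_map_truncate_eq_top hta ?_ (y_pow_mul_mem mul_mem fun i hi => ?_)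
    · rw [eq_top_iff, ← hspan, sup_le_iff, Submodule.span_le]
      constructor
      · rintro _ ⟨k, rfl⟩
        exact ⟨w k, by simpa [g] using gen_mem (Fin.castAdd d k), hw k⟩
      · rintro _ ⟨e, rfl⟩
        obtain ⟨e, rfl⟩ := truncate_surjective hta e
        exact ⟨_, mul_mem e, by simp [truncate_x, truncate_y]⟩
    · simpa [g, -Fin.natAdd_mk] using gen_mem (Fin.natAdd t ⟨i, by omega⟩)
  have y_pow_mul (e) : y F (t + d) (a + t) ^ a * (y F (t + d) (a + t) ^ t * e) = 0 := by
    rw [← mul_assoc, ← pow_add, y_pow, zero_mul]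
  refine hasJordanType_of_generators ?_ g (Fin.addCases (fun k => ?_) fun j => ?_)
    fun i _ => hW.ge Submodule.mem_top
  · rw [finrank_eq] at hμ
    simp only [Fin.sum_univ_add, Fin.append_left, Fin.append_right, Finset.sum_add_distrib, hμ,
      Finset.sum_const, Finset.card_univ, Fintype.card_fin, smul_eq_mul]
    ring
  · obtain ⟨e, he⟩ := y_pow_dvd_of_truncate_eq_zero hta
      (a := (x F (t + d) (a + t) + y F (t + d) (a + t)) ^ μ k * w k) (by
        simpa [truncate_x, truncate_y, hw, LinearMap.pow_mulLeft] using hv k)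
    simp only [g, Fin.append_left]
    rw [pow_add _ a (μ k), mul_assoc, he, x_add_y_pow_of_dvd hp hm ha, y_pow_mul]
  · simp only [g, Fin.append_right]
    rw [x_add_y_pow_of_dvd hp hm ha, y_pow_mul]

theorem hasJordanType_of_triangular {t : ℕ} {μ : Fin t → ℕ} (hμ : ∑ k, μ k = t * s)
    (c : Fin t → F) (d : Fin t → TruncatedTensor F t s) (hc : ∀ k, c k ≠ 0)
    (hv : ∀ k, (x F t s + y F t s) ^ μ k *
      (algebraMap F _ (c k) * x F t s ^ (k : ℕ) + (x F t s + y F t s) * d k) = 0) :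
    HasJordanType (LinearMap.mulLeft F (x F t s + y F t s)) μ := by
  refine hasJordanType_of_generators hμ _ hv fun i hi => ?_
  have hxi : x F t s ^ i = (c ⟨i, hi⟩)⁻¹ • (algebraMap F _ (c ⟨i, hi⟩) * x F t s ^ i +
      (x F t s + y F t s) * d ⟨i, hi⟩) - (x F t s + y F t s) * ((c ⟨i, hi⟩)⁻¹ • d ⟨i, hi⟩) := by
    rw [smul_add, ← Algebra.smul_def, inv_smul_smul₀ (hc _), mul_smul_comm, add_sub_cancel_right]
  rw [hxi]
  exact Submodule.sub_mem _ (Submodule.mem_sup_left (Submodule.smul_mem _ _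
    (Submodule.subset_span ⟨⟨i, hi⟩, rfl⟩))) (Submodule.mem_sup_right ⟨_, rfl⟩)

theorem hasJordanType_one : HasJordanType (LinearMap.mulLeft F (x F 1 s + y F 1 s)) ![s] := by
  have hx : x F 1 s = 0 := by simpa using x_pow F 1 s
  refine hasJordanType_of_triangular (by simp) ![1] ![0] (by simp) ?_
  simp [hx, y_pow]

end TruncatedTensor

section PowerRelations

variable {A : Type*} [CommRing A] {x y : A}

theorem sub_pow_of_sq_eq_zero (hx : x ^ 2 = 0) (z : A) (n : ℕ) :
    (z - x) ^ (n + 1) = z ^ n * (z - (n + 1 : ℕ) * x) := by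
  induction n with
  | zero => simp
  | succ n ih =>
    rw [pow_succ, ih]
    push_cast
    linear_combination z ^ n * (n + 1) * hx

theorem sub_pow_of_cube_eq_zero (hx : x ^ 3 = 0) (z : A) (n : ℕ) :
    (z - x) ^ (n + 2) =
      z ^ n * (z ^ 2 - (n + 2 : ℕ) * z * x + ((n + 2).choose 2 : ℕ) * x ^ 2) := by
  induction n with
  | zero =>
    simp only [zero_add, pow_zero, Nat.cast_ofNat, Nat.choose_self, Nat.cast_one, one_mul]
    ring
  | succ n ih =>
    rw [pow_succ, ih, show n + 1 + 2 = n + 2 + 1 from rfl, Nat.choose_succ_succ' (n + 2) 1,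
      Nat.choose_one_right]
    push_cast
    linear_combination -z ^ n * ((n + 2).choose 2 : ℕ) * hx

theorem sq_eq_choose_two_add_choose_two (n : ℕ) :
    n ^ 2 = n.choose 2 + (n + 1).choose 2 := by
  induction n with
  | zero => rfl
  | succ n ih =>
    have h := Nat.choose_succ_succ' (n + 1) 1
    have h' := Nat.choose_succ_succ' n 1
    rw [Nat.choose_one_right] at h h'
    linarith

variable {n : ℕ}

theorem add_pow_mul_linear_eq_zero (hx : x ^ 2 = 0) (hy : y ^ (n + 1) = 0) :
    (x + y) ^ n * (x + y - (n + 1 : ℕ) * x) = 0 := by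
  rw [← sub_pow_of_sq_eq_zero hx, add_sub_cancel_left, hy]

theorem add_pow_mul_quadratic_eq_zero (hx : x ^ 3 = 0) (hy : y ^ (n + 2) = 0) :
    (x + y) ^ n * ((x + y) ^ 2 - (n + 2 : ℕ) * (x + y) * x + ((n + 2).choose 2 : ℕ) * x ^ 2) =
      0 := by
  rw [← sub_pow_of_cube_eq_zero hx, add_sub_cancel_left, hy]

theorem add_pow_mul_sq_eq_zero (hx : x ^ 3 = 0) (hy : y ^ (n + 2) = 0) :
    (x + y) ^ (n + 2) * x ^ 2 = 0 := by
  linear_combination x ^ 2 * add_pow_mul_quadratic_eq_zero hx hy +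
    ((n + 2 : ℕ) * (x + y) ^ (n + 1) - ((n + 2).choose 2 : ℕ) * (x + y) ^ n * x) * hx

theorem add_pow_mul_eq_natCast_mul (hx : x ^ 3 = 0) (hy : y ^ (n + 2) = 0) :
    (x + y) ^ (n + 2) * x = (n + 2 : ℕ) * ((x + y) ^ (n + 1) * x ^ 2) := by
  linear_combination x * add_pow_mul_quadratic_eq_zero hx hy -
    ((n + 2).choose 2 : ℕ) * (x + y) ^ n * hx

theorem add_pow_eq_choose_mul (hx : x ^ 3 = 0) (hy : y ^ (n + 2) = 0) :
    (x + y) ^ (n + 3) = ((n + 3).choose 2 : ℕ) * ((x + y) ^ (n + 1) * x ^ 2) := by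
  have hchoose : ((n + 2 : ℕ) : A) ^ 2 = ((n + 2).choose 2 : ℕ) + ((n + 3).choose 2 : ℕ) :=
    mod_cast congrArg Nat.cast (sq_eq_choose_two_add_choose_two (n + 2))
  linear_combination (x + y) * add_pow_mul_quadratic_eq_zero hx hy +
    (n + 2 : ℕ) * add_pow_mul_eq_natCast_mul hx hy + (x + y) ^ (n + 1) * x ^ 2 * hchoose

end PowerRelations

namespace TruncatedTensor

variable {F : Type*} [Field F] {n : ℕ}

theorem natCast_eq_zero {r s m : ℕ} (hm : (m : F) = 0) : (m : TruncatedTensor F r s) = 0 := by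
  rw [← map_natCast (algebraMap F _), hm, map_zero]

theorem hasJordanType_two_of_ne_zero (hn : ((n + 1 : ℕ) : F) ≠ 0) :
    HasJordanType (LinearMap.mulLeft F (x F 2 (n + 1) + y F 2 (n + 1))) ![n + 2, n] := by
  have hx := x_pow F 2 (n + 1)
  have hrel := add_pow_mul_linear_eq_zero hx (y_pow F 2 (n + 1))
  refine hasJordanType_of_triangular (by simp only [Fin.sum_univ_two, Matrix.cons_val]; ring)
    ![1, (n + 1 : ℕ)] ![0, -1] ?_ ?_
  · simpa [Fin.forall_fin_two] using hn
  · simp only [Fin.forall_fin_two, Matrix.cons_val_zero, Matrix.cons_val_one, map_one, map_natCast,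
      Fin.val_zero, Fin.val_one]
    generalize x F 2 (n + 1) + y F 2 (n + 1) = z at *
    refine ⟨?_, ?_⟩
    · linear_combination (z + (n + 1 : ℕ) * x F 2 (n + 1)) * hrel +
        (n + 1 : ℕ) ^ 2 * z ^ n * hx
    · linear_combination -hrel

theorem hasJordanType_two_of_eq_zero (hn : ((n + 1 : ℕ) : F) = 0) :
    HasJordanType (LinearMap.mulLeft F (x F 2 (n + 1) + y F 2 (n + 1))) ![n + 1, n + 1] := by
  have hrel := add_pow_mul_linear_eq_zero (x_pow F 2 (n + 1)) (y_pow F 2 (n + 1))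
  rw [natCast_eq_zero hn, zero_mul, sub_zero, ← pow_succ] at hrel
  refine hasJordanType_of_triangular (by simp only [Fin.sum_univ_two, Matrix.cons_val]; ring) 1 0
    (fun _ => one_ne_zero) ?_
  simp [Fin.forall_fin_two, hrel]

theorem hasJordanType_three_of_ne_zero_of_ne_zero (h : ((n + 2).choose 2 : F) ≠ 0)
    (h' : ((n + 3).choose 2 : F) ≠ 0) :
    HasJordanType (LinearMap.mulLeft F (x F 3 (n + 2) + y F 3 (n + 2))) ![n + 4, n + 2, n] := by
  have hx := x_pow F 3 (n + 2)
  have hy := y_pow F 3 (n + 2)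
  refine hasJordanType_of_triangular (by simp only [Fin.sum_univ_three, Matrix.cons_val]; ring)
    ![1, (n + 3).choose 2, (n + 2).choose 2]
    ![0, -(n + 2 : ℕ), x F 3 (n + 2) + y F 3 (n + 2) - (n + 2 : ℕ) * x F 3 (n + 2)] ?_ ?_
  · simp [Fin.forall_fin_succ, h, h']
  · simp only [Fin.forall_fin_succ, Matrix.cons_val_zero, Matrix.cons_val_succ, map_one,
      map_natCast, Fin.val_zero, Fin.val_succ, IsEmpty.forall_iff, and_true]
    refine ⟨?_, ?_, ?_⟩
    · linear_combination (x F 3 (n + 2) + y F 3 (n + 2)) * add_pow_eq_choose_mul hx hy +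
        ((n + 3).choose 2 : ℕ) * add_pow_mul_sq_eq_zero hx hy
    · linear_combination ((n + 3).choose 2 : ℕ) * add_pow_mul_eq_natCast_mul hx hy -
        (n + 2 : ℕ) * add_pow_eq_choose_mul hx hy
    · linear_combination add_pow_mul_quadratic_eq_zero hx hy

theorem hasJordanType_three_of_ne_zero_of_eq_zero (h : ((n + 2).choose 2 : F) ≠ 0)
    (h' : ((n + 3).choose 2 : F) = 0) :
    HasJordanType (LinearMap.mulLeft F (x F 3 (n + 2) + y F 3 (n + 2))) ![n + 3, n + 3, n] := by
  have hx := x_pow F 3 (n + 2)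
  have hy := y_pow F 3 (n + 2)
  have hpow := add_pow_eq_choose_mul hx hy
  rw [natCast_eq_zero h', zero_mul] at hpow
  refine hasJordanType_of_triangular (by simp only [Fin.sum_univ_three, Matrix.cons_val]; ring)
    ![1, 1, (n + 2).choose 2]
    ![0, 0, x F 3 (n + 2) + y F 3 (n + 2) - (n + 2 : ℕ) * x F 3 (n + 2)] ?_ ?_
  · simp [Fin.forall_fin_succ, h]
  · simp only [Fin.forall_fin_succ, Matrix.cons_val_zero, Matrix.cons_val_succ, map_one,
      map_natCast, Fin.val_zero, Fin.val_succ, IsEmpty.forall_iff, and_true]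
    refine ⟨?_, ?_, ?_⟩
    · linear_combination hpow
    · linear_combination x F 3 (n + 2) * hpow
    · linear_combination add_pow_mul_quadratic_eq_zero hx hy

theorem hasJordanType_three_of_eq_zero_of_ne_zero (h : ((n + 2).choose 2 : F) = 0)
    (hn : ((n + 2 : ℕ) : F) ≠ 0) :
    HasJordanType (LinearMap.mulLeft F (x F 3 (n + 2) + y F 3 (n + 2))) ![n + 4, n + 1, n + 1] := by
  have hx := x_pow F 3 (n + 2)
  have hy := y_pow F 3 (n + 2)
  have hrel := add_pow_mul_quadratic_eq_zero hx hy
  rw [natCast_eq_zero h, zero_mul, add_zero] at hrel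
  refine hasJordanType_of_triangular (by simp only [Fin.sum_univ_three, Matrix.cons_val]; ring)
    ![1, (n + 2 : ℕ), (n + 2 : ℕ)] ![0, -1, -x F 3 (n + 2)] ?_ ?_
  · simpa [Fin.forall_fin_succ] using hn
  · simp only [Fin.forall_fin_succ, Matrix.cons_val_zero, Matrix.cons_val_succ, map_one,
      map_natCast, Fin.val_zero, Fin.val_succ, IsEmpty.forall_iff, and_true]
    refine ⟨?_, ?_, ?_⟩
    · linear_combination (x F 3 (n + 2) + y F 3 (n + 2)) * add_pow_eq_choose_mul hx hy +
        ((n + 3).choose 2 : ℕ) * add_pow_mul_sq_eq_zero hx hy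
    · linear_combination -hrel
    · linear_combination -x F 3 (n + 2) * hrel

theorem hasJordanType_three_of_eq_zero_of_eq_zero (h : ((n + 2).choose 2 : F) = 0)
    (hn : ((n + 2 : ℕ) : F) = 0) :
    HasJordanType (LinearMap.mulLeft F (x F 3 (n + 2) + y F 3 (n + 2))) ![n + 2, n + 2, n + 2] := by
  have hrel := add_pow_mul_quadratic_eq_zero (x_pow F 3 (n + 2)) (y_pow F 3 (n + 2))
  rw [natCast_eq_zero h, natCast_eq_zero hn, zero_mul, zero_mul, zero_mul, sub_zero, add_zero,
    ← pow_add] at hrel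
  refine hasJordanType_of_triangular (by simp only [Fin.sum_univ_three, Matrix.cons_val]; ring) 1 0
    (fun _ => one_ne_zero) ?_
  simp [Fin.forall_fin_succ, hrel]

end TruncatedTensor

section NormanPermutation

open TruncatedTensor

theorem IsNormanPermutation.map {R S : Type*} [CommRing R] [CommRing S] (φ : R →+* S) {r s : ℕ}
    {σ : Equiv.Perm ℕ} (h : IsNormanPermutation R r s σ) : IsNormanPermutation S r s σ := by
  obtain ⟨hσ, lam, hlam, hformula⟩ := h
  refine ⟨hσ, lam, ⟨hlam.antitone, hlam.pos, ?_⟩, hformula⟩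
  have hmap := hlam.jordanForm.map φ
  have hkronecker : (unipotentJordanBlock R r ⊗ₖ unipotentJordanBlock R s).map φ =
      unipotentJordanBlock S r ⊗ₖ unipotentJordanBlock S s := by
    ext i j
    simp only [← unipotentJordanBlock_map φ, Matrix.map_apply, Matrix.kroneckerMap_apply, map_mul]
  rwa [hkronecker] at hmap

variable {F : Type*} [Field F] {r s : ℕ} {σ τ : Equiv.Perm ℕ}

theorem isNormanPermutation_iff : IsNormanPermutation F r s σ ↔
    (∀ n, n ∉ Set.Icc 1 r → σ n = n) ∧ ∃ lam : Fin r → ℕ, Antitone lam ∧ (∀ k, 0 < lam k) ∧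
      HasJordanType (LinearMap.mulLeft F (x F r s + y F r s)) lam ∧
        ∀ k : Fin r, (σ (k + 1) : ℤ) = ((r : ℤ) + 1 - ((k : ℤ) + 1)) + s - lam k := by
  constructor
  · rintro ⟨hσ, lam, ⟨hanti, hpos, hform⟩, hformula⟩
    exact ⟨hσ, lam, hanti, hpos, hasUnipotentJordanForm_kronecker_iff.1 hform, hformula⟩
  · rintro ⟨hσ, lam, hanti, hpos, htype, hformula⟩
    exact ⟨hσ, lam, ⟨hanti, hpos, hasUnipotentJordanForm_kronecker_iff.2 htype⟩, hformula⟩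

theorem IsNormanPermutation.eq (hσ : IsNormanPermutation F r s σ)
    (hτ : IsNormanPermutation F r s τ) : σ = τ := by
  obtain ⟨σ_fixes, lam, hlam, -, hlam_type, hσ⟩ := isNormanPermutation_iff.1 hσ
  obtain ⟨τ_fixes, lam', hlam', -, hlam'_type, hτ⟩ := isNormanPermutation_iff.1 hτ
  obtain rfl := hlam_type.eq_of_antitone hlam'_type hlam hlam'
  ext n
  by_cases hn : n ∈ Set.Icc 1 r
  · obtain ⟨k, rfl⟩ := Nat.exists_eq_add_of_le' hn.1
    exact_mod_cast (hσ ⟨k, hn.2⟩).trans (hτ ⟨k, hn.2⟩).symm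
  · rw [σ_fixes n hn, τ_fixes n hn]

theorem IsNormanPermutation.normanPermutation_eq {p : ℕ} [Fact p.Prime]
    (h : IsNormanPermutation (ZMod p) r s σ) : normanPermutation r s p = σ := by
  have hex : ∃ σ, IsNormanPermutation (ZMod p) r s σ := ⟨σ, h⟩
  rw [normanPermutation, dif_pos hex]
  exact hex.choose_spec.eq h

theorem IsNormanPermutation.wellDefined {p : ℕ} [Fact p.Prime]
    (h : IsNormanPermutation (ZMod p) r s σ) : NormanPermutationWellDefined.{u} r s p := by
  intro F _ _ τ
  have hF : IsNormanPermutation F r s σ := h.map (ZMod.castHom (dvd_refl p) F)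
  rw [h.normanPermutation_eq]
  exact ⟨fun hτ => hτ.eq hF, fun hτ => hτ ▸ hF⟩

theorem IsNormanPermutation.mul_reversalPerm {p m a t d : ℕ} [CharP F p] (hp : p.Prime)
    (hm : t + d ≤ p ^ m) (ha : p ^ m ∣ a) (hd : d ≤ a)
    (h : IsNormanPermutation F t (t + d) τ) :
    IsNormanPermutation F (t + d) (a + t) (τ * reversalPerm (t + 1) (t + d)) := by
  obtain ⟨τ_fixes, lam, hanti, hpos, htype, hτ⟩ := isNormanPermutation_iff.1 h
  have reversal_apply (n : ℕ) : reversalPerm (t + 1) (t + d) n =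
    if t + 1 ≤ n ∧ n ≤ t + d then t + d + (t + 1) - n else n := rfl
  refine isNormanPermutation_iff.2 ⟨fun n hn => ?_, _, fun i j hij => ?_, ?_,
    hasJordanType_append hp hm ha (hasJordanType_swap_iff.2 htype), ?_⟩
  · rw [Set.mem_Icc] at hn
    rw [Equiv.Perm.mul_apply, reversal_apply, if_neg (by omega),
      τ_fixes n (by rw [Set.mem_Icc]; omega)]
  · induction i using Fin.addCases with
    | left i =>
      induction j using Fin.addCases with
      | left j => simpa using hanti hij
      | right j => simp
    | right i =>
      induction j using Fin.addCases with
      | left j =>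
        rw [Fin.le_def, Fin.val_natAdd, Fin.val_castAdd] at hij
        omega
      | right j => simp
  · refine Fin.addCases (fun k => ?_) fun k => ?_
    · rw [Fin.append_left]
      exact Nat.add_pos_right a (hpos k)
    · rw [Fin.append_right]
      exact (Nat.zero_le _).trans_lt (k.isLt.trans_le hd)
  · refine Fin.addCases (fun k => ?_) fun k => ?_
    · have := hτ k
      rw [Equiv.Perm.mul_apply, reversal_apply, Fin.append_left, Fin.val_castAdd, if_neg (by omega)]
      omega
    · rw [Equiv.Perm.mul_apply, reversal_apply, Fin.append_right, Fin.val_natAdd,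
        if_pos (by omega), τ_fixes _ (by rw [Set.mem_Icc]; omega)]
      omega

theorem IsNormanPermutation.mul_reversalPerm_of_mod {p m : ℕ} [CharP F p] (hp : p.Prime)
    (hrs : r ≤ s) (hm : r ≤ p ^ m) (hs : s % p ^ m ≤ r)
    (h : IsNormanPermutation F (s % p ^ m) r τ) :
    IsNormanPermutation F r s (τ * reversalPerm (s % p ^ m + 1) r) := by
  obtain ⟨d, hd⟩ := Nat.exists_eq_add_of_le hs
  have hdiv := Nat.div_add_mod s (p ^ m)
  have hdvd : p ^ m ∣ p ^ m * (s / p ^ m) := dvd_mul_right _ _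
  generalize s % p ^ m = t, p ^ m * (s / p ^ m) = a at *
  subst hd hdiv
  exact h.mul_reversalPerm hp hm hdvd (by omega)

theorem swap_apply_of_notMem_Icc {i j k t : ℕ} (hi : i ∈ Set.Icc 1 t) (hj : j ∈ Set.Icc 1 t)
    (hk : k ∉ Set.Icc 1 t) : Equiv.swap i j k = k :=
  Equiv.swap_apply_of_ne_of_ne (ne_of_mem_of_not_mem hi hk).symm (ne_of_mem_of_not_mem hj hk).symm

theorem isNormanPermutation_zero : IsNormanPermutation F 0 s 1 := by
  refine isNormanPermutation_iff.2 ⟨fun _ _ => rfl, ![], Subsingleton.antitone _,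
    fun k => k.elim0, ?_, fun k => k.elim0⟩
  exact hasJordanType_of_generators (by simp) ![] (fun k => k.elim0) fun i hi =>
    absurd hi i.not_lt_zero

theorem isNormanPermutation_one (hs : 0 < s) : IsNormanPermutation F 1 s 1 := by
  exact isNormanPermutation_iff.2 ⟨fun _ _ => rfl, ![s], Subsingleton.antitone _,
    by simpa using hs, hasJordanType_one, by simp⟩

theorem isNormanPermutation_two_of_hasJordanType {a b : ℕ} (hab : b ≤ a) (hb : 0 < b)
    (h : HasJordanType (LinearMap.mulLeft F (x F 2 s + y F 2 s)) ![a, b])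
    (hσ : ∀ n, n ∉ Set.Icc 1 2 → σ n = n) (h1 : a + σ 1 = s + 2) (h2 : b + σ 2 = s + 1) :
    IsNormanPermutation F 2 s σ := by
  refine isNormanPermutation_iff.2 ⟨hσ, _, ?_, ?_, h, ?_⟩
  · simpa [Fin.antitone_iff_succ_le] using hab
  · simpa [Fin.forall_fin_two, hb] using hb.trans_le hab
  · simp only [Fin.forall_fin_two, Matrix.cons_val_zero, Matrix.cons_val_one, Fin.val_zero,
      Fin.val_one, zero_add, Nat.reduceAdd]
    omega

theorem isNormanPermutation_two_of_ne_zero (hs : 2 ≤ s) (h : (s : F) ≠ 0) :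
    IsNormanPermutation F 2 s 1 := by
  obtain ⟨n, rfl⟩ := Nat.exists_eq_add_of_le' (one_le_two.trans hs)
  exact isNormanPermutation_two_of_hasJordanType (by omega) (by omega)
    (hasJordanType_two_of_ne_zero h) (fun _ _ => rfl) rfl rfl

theorem isNormanPermutation_two_of_eq_zero (hs : 2 ≤ s) (h : (s : F) = 0) :
    IsNormanPermutation F 2 s (Equiv.swap 1 2) := by
  obtain ⟨n, rfl⟩ := Nat.exists_eq_add_of_le' (one_le_two.trans hs)
  exact isNormanPermutation_two_of_hasJordanType le_rfl (by omega)
    (hasJordanType_two_of_eq_zero h) (fun _ => swap_apply_of_notMem_Icc (by simp) (by simp)) rfl rfl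

theorem isNormanPermutation_three_of_hasJordanType {a b c : ℕ} (hab : b ≤ a) (hbc : c ≤ b)
    (hc : 0 < c) (h : HasJordanType (LinearMap.mulLeft F (x F 3 s + y F 3 s)) ![a, b, c])
    (hσ : ∀ n, n ∉ Set.Icc 1 3 → σ n = n) (h1 : a + σ 1 = s + 3) (h2 : b + σ 2 = s + 2)
    (h3 : c + σ 3 = s + 1) : IsNormanPermutation F 3 s σ := by
  refine isNormanPermutation_iff.2 ⟨hσ, _, ?_, ?_, h, ?_⟩
  · simpa [Fin.antitone_iff_succ_le, Fin.forall_fin_two] using ⟨hab, hbc⟩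
  · simpa [Fin.forall_fin_succ, hc] using ⟨hc.trans_le (hbc.trans hab), hc.trans_le hbc⟩
  · simp only [Fin.forall_fin_succ, Matrix.cons_val_zero, Matrix.cons_val_succ, Fin.val_zero,
      Fin.val_succ, zero_add, Nat.reduceAdd, IsEmpty.forall_iff, and_true]
    omega

theorem exists_isNormanPermutation_three (F : Type*) [Field F] (hs : 3 ≤ s) :
    ∃ σ, IsNormanPermutation F 3 s σ := by
  obtain ⟨n, rfl⟩ := Nat.exists_eq_add_of_le' (Nat.le_of_succ_le hs)
  by_cases h : ((n + 2).choose 2 : F) = 0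
  · by_cases hn : ((n + 2 : ℕ) : F) = 0
    · exact ⟨Equiv.swap 1 3, isNormanPermutation_three_of_hasJordanType le_rfl le_rfl (by omega)
        (hasJordanType_three_of_eq_zero_of_eq_zero h hn)
        (fun _ => swap_apply_of_notMem_Icc (by simp) (by simp)) rfl rfl rfl⟩
    · exact ⟨Equiv.swap 2 3, isNormanPermutation_three_of_hasJordanType (by omega) le_rfl
        (by omega) (hasJordanType_three_of_eq_zero_of_ne_zero h hn)
        (fun _ => swap_apply_of_notMem_Icc (by simp) (by simp)) rfl rfl rfl⟩
  · by_cases h' : ((n + 3).choose 2 : F) = 0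
    · exact ⟨Equiv.swap 1 2, isNormanPermutation_three_of_hasJordanType le_rfl (by omega)
        (by omega) (hasJordanType_three_of_ne_zero_of_eq_zero h h')
        (fun _ => swap_apply_of_notMem_Icc (by simp) (by simp)) rfl rfl rfl⟩
    · exact ⟨1, isNormanPermutation_three_of_hasJordanType (by omega) (by omega) (by omega)
        (hasJordanType_three_of_ne_zero_of_ne_zero h h') (fun _ _ => rfl) rfl rfl rfl⟩

end NormanPermutation

theorem mainTheorem10 (r s p m : ℕ) (hr : 1 ≤ r) (hrs : r ≤ s) (hp : p.Prime)
    (hm : r ≤ p ^ m) :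
    (s % p ^ m = 0 →
      NormanPermutationWellDefined.{u} r s p ∧
        normanPermutation r s p = reversalPerm 1 r) ∧
    (2 ≤ r → s % p ^ m = 1 →
      NormanPermutationWellDefined.{u} r s p ∧
        normanPermutation r s p = reversalPerm 2 r) ∧
    (3 ≤ r → s % p ^ m = 2 → r % p = 0 →
      NormanPermutationWellDefined.{u} r s p ∧
        normanPermutation r s p = Equiv.swap 1 2 * reversalPerm 3 r) ∧
    (3 ≤ r → s % p ^ m = 2 → r % p ≠ 0 →
      NormanPermutationWellDefined.{u} r s p ∧
        normanPermutation r s p = reversalPerm 3 r) ∧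
    (4 ≤ r → s % p ^ m = 3 →
      NormanPermutationWellDefined.{u} r s p ∧
        NormanPermutationWellDefined.{u} 3 r p ∧
        normanPermutation r s p = normanPermutation 3 r p * reversalPerm 4 r) := by
  have : Fact p.Prime := ⟨hp⟩
  have cast_eq_zero_iff : (r : ZMod p) = 0 ↔ r % p = 0 := by
    rw [ZMod.natCast_eq_zero_iff, Nat.dvd_iff_mod_eq_zero]
  have reduction {t : ℕ} {τ : Equiv.Perm ℕ} (hs : s % p ^ m = t) (ht : t ≤ r)
      (h : IsNormanPermutation (ZMod p) t r τ) : NormanPermutationWellDefined.{u} r s p ∧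
        normanPermutation r s p = τ * reversalPerm (t + 1) r := by
    subst hs
    have hσ := h.mul_reversalPerm_of_mod hp hrs hm ht
    exact ⟨hσ.wellDefined, hσ.normanPermutation_eq⟩
  refine ⟨fun hs => reduction hs (by omega) isNormanPermutation_zero,
    fun _ hs => reduction hs (by omega) (isNormanPermutation_one hr),
    fun h3 hs hpr => reduction hs (by omega)
      (isNormanPermutation_two_of_eq_zero (by omega) (cast_eq_zero_iff.2 hpr)),
    fun h3 hs hpr => reduction hs (by omega)
      (isNormanPermutation_two_of_ne_zero (by omega) (cast_eq_zero_iff.not.2 hpr)),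
    fun h4 hs => ?_⟩
  obtain ⟨τ, hτ⟩ := exists_isNormanPermutation_three (ZMod p) (s := r) (by omega)
  rw [hτ.normanPermutation_eq]
  exact ⟨(reduction hs (by omega) hτ).1, hτ.wellDefined, (reduction hs (by omega) hτ).2⟩
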